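/- Infinite words are elements of $\{0,1,2\}^{\mathbb N}$, and $\mathcal L(x)$ denotes the set of factors (finite blocks of consecutive letters) of $x$. Two finite words are abelian equivalent if each letter occurs equally often in both. Put $$\mathcal A(x)=\{y : \text{every } u\in\mathcal L(y) \text{ is abelian equivalent to some } v\in\mathcal L(x)\},\qquad \Omega(x)=\{y : \mathcal L(y)\subseteq \mathcal L(x)\}$$ (the abelian closure and the shift orbit closure of $x$). Let $\alpha\in(0,1/2)$ be irrational, $\mathbb T=\mathbb R/\mathbb Z$ and $\zeta\in[\alpha,1-\alpha]$. Let $J_1\subset\mathbb T$ be one of the half-open arcs $[1-\alpha,1)$, $(1-\alpha,1]$, let $J_2\subset\mathbb T$ be one of the half-open arcs $[\zeta-\alpha,\zeta)$, $(\zeta-\alpha,\zeta]$, and let $J_0=\mathbb T\setminus(J_1\cup J_2)$. The choice of end points is called admissible if $J_1\cap J_2=\emptyset$; that is, all choices are admissible except $J_1=(1-\alpha,1]$, $J_2=[0,\alpha)$ when $\zeta=\alpha$, and $J_1=[1-\alpha,1)$, $J_2=(1-2\alpha,1-\alpha]$ when $\zeta=1-\alpha$. For $\rho\in\mathbb T$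 and an admissible choice of end points, the ternary coding of rotation $t_{\alpha,\zeta,\rho}$ is the word whose $n$-th letter ($n\ge 0$) is the $i$ with $\rho+n\alpha\in J_i$. **Proposition.** Let $u=t_{\alpha,\alpha,\rho}$ for some $\rho\in\mathbb T$ and some admissible choice of end points. Then $$\mathcal A(u)=\bigcup_{\zeta\in[\alpha,1-\alpha]}\ \bigcup_{\rho'\in\mathbb T}\ \Omega(t_{\alpha,\zeta,\rho'}),$$ where the union is also over all admissible choices of end points in $t_{\alpha,\zeta,\rho'}$. -/

import Mathlib

/-! Infinite words over an alphabet `A` are functions `ℕ → A`; finite words are lists. -/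

/-- The block of length `n` of the infinite word `x` starting at position `i`. -/
def wordBlock {A : Type*} (x : ℕ → A) (i n : ℕ) : List A :=
  List.ofFn fun j : Fin n => x (i + j)

/-- The language of an infinite word: the set of its factors (blocks of consecutive letters,
including the empty one). -/
def wordLanguage {A : Type*} (x : ℕ → A) : Set (List A) :=
  {w | ∃ i n : ℕ, w = wordBlock x i n}

/-- Abelian equivalence of finite words: each letter occurs equally many times in both. -/
def AbelianEquiv {A : Type*} [DecidableEq A] (u v : List A) : Prop :=
  ∀ a : A, u.count a = v.count a

/-- The abelian closure of an infinite word `x`: the infinite words each of whose factors is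
abelian equivalent to some factor of `x`. -/
def abelianClosure {A : Type*} [DecidableEq A] (x : ℕ → A) : Set (ℕ → A) :=
  {y | ∀ u ∈ wordLanguage y, ∃ v ∈ wordLanguage x, AbelianEquiv u v}

/-- The shift orbit closure of an infinite word `x`: the infinite words all of whose factors
are factors of `x`. -/
def orbitClosure {A : Type*} (x : ℕ → A) : Set (ℕ → A) :=
  {y | wordLanguage y ⊆ wordLanguage x}

/-- Which end point a half-open arc contains. -/
inductive ArcEnd : Type
  /-- the initial point: the arc is `[a, b)` (written with an underline) -/
  | initial : ArcEnd
  /-- the final point: the arc is `(a, b]` (written with an overline) -/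
  | final : ArcEnd

/-- The half-open arc on the circle `ℝ / ℤ` from `a` counter-clockwise to `b`, where
`a < b ≤ a + 1`. -/
def halfOpenArc : ArcEnd → ℝ → ℝ → Set UnitAddCircle
  | ArcEnd.initial, a, b => (fun t : ℝ => (t : UnitAddCircle)) '' Set.Ico a b
  | ArcEnd.final, a, b => (fun t : ℝ => (t : UnitAddCircle)) '' Set.Ioc a b

/-- The arc `J₁` from `1 - α` to `1`. -/
def arcOne (e : ArcEnd) (α : ℝ) : Set UnitAddCircle := halfOpenArc e (1 - α) 1

/-- The arc `J₂` from `ζ - α` to `ζ`. -/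
def arcTwo (f : ArcEnd) (α ζ : ℝ) : Set UnitAddCircle := halfOpenArc f (ζ - α) ζ

/-- The choices `e`, `f` of end points of `J₁`, `J₂` that are allowed for offset `ζ`. All are,
except the two for which the arcs would overlap: if `ζ = α` and `1 ∈ J₁` then `J₂` must be
`(0, α]`; if `ζ = 1 - α` and `1 - α ∈ J₁` then `J₂` must be `[1 - 2α, 1 - α)`. -/
def AdmissibleEnds (e f : ArcEnd) (α ζ : ℝ) : Prop :=
  (ζ = α → e = ArcEnd.final → f = ArcEnd.final) ∧
    (ζ = 1 - α → e = ArcEnd.initial → f = ArcEnd.initial)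

open Classical in
/-- The coding of the circle: `1` on `J₁`, `2` on `J₂`, and `0` on the rest `J₀`. -/
noncomputable def ternaryCode (e f : ArcEnd) (α ζ : ℝ) (z : UnitAddCircle) : Fin 3 :=
  if z ∈ arcOne e α then 1 else if z ∈ arcTwo f α ζ then 2 else 0

/-- The ternary coding of rotation of slope `α`, offset `ζ` and intercept `ρ`, with end point
choices `e` for `J₁` and `f` for `J₂`: the coding of the orbit of `ρ` under rotation by `α`. -/
noncomputable def ternaryRotationWord (e f : ArcEnd) (α ζ : ℝ) (ρ : UnitAddCircle) :
    ℕ → Fin 3 :=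
  fun n => ternaryCode e f α ζ (ρ + n • (α : UnitAddCircle))

/-! An arc of length `α` is detected by a jump of a rounded line, so in a length-`n` block the
counts of `1` and `2` are increments of `endRound` over windows of length `n * α` starting at `r`
and `r - ζ`. With `n * α = m + b`, `0 < b < 1`, each count is `m` or `m + 1`.

For offset `α` the mixed pairs always occur, `(m, m)` occurs when `b < 1 - α`, and `(m + 1, m + 1)`
when `α < b`; density of the orbit realises them (`exists_Ioo_endRound_sub_eq`). For `ζ` in `[α, 1 -
α]` the equal pairs force the same bounds, since integers and points of `ζ + ℤ` are at least `α`
apart. Hence every such coding lies in the closure.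

Conversely, counts deviating from `n * α` by less than one make both prefix counts rounded lines
(`exists_eq_endRound`), so the word is read off two arcs of length `α`. No letter is both `1` and
`2`; density then forces `ζ` into `[α, 1 - α]` and leaves only end points to adjust
(`exists_admissible_of_arcs`). -/

/-! ### Rounding functions and half-open arcs -/

/-- Rounding down for an arc with its initial point, rounding up for one with its final point. -/
noncomputable def endRound : ArcEnd → ℝ → ℤ
  | ArcEnd.initial, r => ⌊r⌋
  | ArcEnd.final, r => ⌈r⌉

/-- The half-open interval of which `halfOpenArc` is the image. -/
def halfOpenInterval : ArcEnd → ℝ → ℝ → Set ℝ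
  | ArcEnd.initial, a, b => Set.Ico a b
  | ArcEnd.final, a, b => Set.Ioc a b

theorem halfOpenInterval_subset_Icc (e : ArcEnd) (a b : ℝ) :
    halfOpenInterval e a b ⊆ Set.Icc a b := by
  cases e
  · exact Set.Ico_subset_Icc_self
  · exact Set.Ioc_subset_Icc_self

theorem Ioo_subset_halfOpenInterval (e : ArcEnd) (a b : ℝ) :
    Set.Ioo a b ⊆ halfOpenInterval e a b := by
  cases e
  · exact Set.Ioo_subset_Ico_self
  · exact Set.Ioo_subset_Ioc_self

theorem coe_eq_coe_iff_exists_int {r t : ℝ} :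
    (r : UnitAddCircle) = t ↔ ∃ k : ℤ, t = r + k := by
  rw [← sub_eq_zero, ← neg_eq_zero, neg_sub, ← AddCircle.coe_sub, AddCircle.coe_eq_zero_iff]
  constructor
  · rintro ⟨k, hk⟩
    refine ⟨k, ?_⟩
    rw [zsmul_one] at hk
    linarith
  · rintro ⟨k, hk⟩
    refine ⟨k, ?_⟩
    rw [zsmul_one]
    linarith

theorem coe_mem_halfOpenArc {e : ArcEnd} {a b r : ℝ} :
    (r : UnitAddCircle) ∈ halfOpenArc e a b ↔ ∃ k : ℤ, r + k ∈ halfOpenInterval e a b := by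
  have h : halfOpenArc e a b = (fun t : ℝ => (t : UnitAddCircle)) '' halfOpenInterval e a b := by
    cases e <;> rfl
  rw [h, Set.mem_image]
  constructor
  · rintro ⟨t, ht, hr⟩
    obtain ⟨k, hk⟩ := coe_eq_coe_iff_exists_int.mp hr.symm
    exact ⟨k, hk ▸ ht⟩
  · rintro ⟨k, hk⟩
    exact ⟨r + k, hk, (coe_eq_coe_iff_exists_int.mpr ⟨k, rfl⟩).symm⟩

theorem endRound_add_int (e : ArcEnd) (r : ℝ) (k : ℤ) :
    endRound e (r + k) = endRound e r + k := by
  cases e <;> simp [endRound]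

/-- Rounding errors fill a half-open interval of length one, so two of them differ by strictly less
than one. -/
theorem abs_endRound_sub_lt (e : ArcEnd) (r t : ℝ) :
    |((endRound e r - endRound e t : ℤ) : ℝ) - (r - t)| < 1 := by
  rw [abs_lt]
  push_cast
  cases e <;> simp only [endRound]
  · have h1 := Int.floor_le r
    have h2 := Int.lt_floor_add_one r
    have h3 := Int.floor_le t
    have h4 := Int.lt_floor_add_one t
    constructor <;> linarith
  · have h1 := Int.le_ceil r
    have h2 := Int.ceil_lt_add_one r
    have h3 := Int.le_ceil t
    have h4 := Int.ceil_lt_add_one t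
    constructor <;> linarith

/-- An increment of the rounding function by one more than `m` comes from an integer in between. -/
theorem exists_int_between_of_endRound_sub {e : ArcEnd} {r b : ℝ} {m : ℤ}
    (h : endRound e (r + (m + b)) - endRound e r = m + 1) :
    ∃ k : ℤ, r ≤ k ∧ (k : ℝ) ≤ r + b := by
  have h' : endRound e (r + b) = endRound e r + 1 := by
    have := endRound_add_int e (r + b) m
    rw [show r + b + (m : ℝ) = r + (m + b) by ring] at this
    omega
  cases e <;> simp only [endRound] at h'
  · refine ⟨⌊r⌋ + 1, ?_, ?_⟩
    · push_cast
      exact (Int.lt_floor_add_one r).le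
    · rw [← h']
      exact Int.floor_le _
  · refine ⟨⌈r⌉, Int.le_ceil r, ?_⟩
    have := Int.ceil_lt_add_one (r + b)
    rw [h'] at this
    push_cast at this
    linarith

/-- An increment of the rounding function by just `m` leaves no integer strictly in between. -/
theorem exists_int_around_of_endRound_sub {e : ArcEnd} {r b : ℝ} {m : ℤ}
    (h : endRound e (r + (m + b)) - endRound e r = m) :
    ∃ k : ℤ, (k : ℝ) ≤ r ∧ r + b ≤ k + 1 := by
  have h' : endRound e (r + b) = endRound e r := by
    have := endRound_add_int e (r + b) m
    rw [show r + b + (m : ℝ) = r + (m + b) by ring] at this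
    omega
  cases e <;> simp only [endRound] at h'
  · refine ⟨⌊r⌋, Int.floor_le r, ?_⟩
    rw [← h']
    exact (Int.lt_floor_add_one _).le
  · refine ⟨⌈r⌉ - 1, ?_, ?_⟩
    · have := Int.ceil_lt_add_one r
      push_cast
      linarith
    · push_cast
      rw [← h']
      linarith [Int.le_ceil (r + b)]

theorem endRound_eq_of_lt_of_lt {e : ArcEnd} {r t : ℝ} {k : ℤ} (h1 : (k : ℝ) < r)
    (h2 : r < k + 1) (h3 : (k : ℝ) < t) (h4 : t < k + 1) : endRound e r = endRound e t := by
  cases e <;> simp only [endRound]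
  · rw [Int.floor_eq_iff.mpr ⟨h1.le, h2⟩, Int.floor_eq_iff.mpr ⟨h3.le, h4⟩]
  · rw [(Int.ceil_eq_iff (z := k + 1)).mpr ⟨by push_cast; linarith, by push_cast; linarith⟩,
      (Int.ceil_eq_iff (z := k + 1)).mpr ⟨by push_cast; linarith, by push_cast; linarith⟩]

/-- Strict inequalities keep the window's ends off the integers, so this partial converse and the
next hold for either kind of rounding. -/
theorem endRound_sub_eq_of_around {e : ArcEnd} {r b : ℝ} {m : ℤ} (hb : 0 ≤ b) (k : ℤ)
    (h1 : (k : ℝ) < r) (h2 : r + b < k + 1) :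
    endRound e (r + (m + b)) - endRound e r = m := by
  have h := endRound_add_int e (r + b) m
  rw [show r + b + (m : ℝ) = r + (m + b) by ring] at h
  have := endRound_eq_of_lt_of_lt (e := e) (r := r + b) (t := r) (k := k)
    (by linarith) h2 h1 (by linarith)
  omega

theorem endRound_sub_eq_of_between {e : ArcEnd} {r b : ℝ} {m : ℤ} (hb : b ≤ 1) (k : ℤ)
    (h1 : r < k) (h2 : (k : ℝ) < r + b) :
    endRound e (r + (m + b)) - endRound e r = m + 1 := by
  have h := endRound_add_int e (r + b) m
  rw [show r + b + (m : ℝ) = r + (m + b) by ring] at h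
  have h' := endRound_add_int e r 1
  have := endRound_eq_of_lt_of_lt (e := e) (r := r + b) (t := r + (1 : ℤ)) (k := k)
    h2 (by linarith) (by push_cast; linarith) (by push_cast; linarith)
  omega

/-- Membership in a half-open arc of length `a` as an increment of the rounding function. -/
theorem endRound_add_sub_eq_ite (e : ArcEnd) {a c r : ℝ} (h0 : 0 < a) (h1 : a < 1)
    [Decidable ((r : UnitAddCircle) ∈ halfOpenArc e (c - a) c)] :
    endRound e (r - c + a) - endRound e (r - c) =
      if (r : UnitAddCircle) ∈ halfOpenArc e (c - a) c then 1 else 0 := by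
  split_ifs with h <;> rw [coe_mem_halfOpenArc] at h
  · obtain ⟨k, hk⟩ := h
    cases e <;> simp only [endRound, halfOpenInterval, Set.mem_Ico, Set.mem_Ioc] at *
    · rw [(Int.floor_eq_iff (z := -k)).mpr ⟨by push_cast; linarith, by push_cast; linarith⟩,
        (Int.floor_eq_iff (z := -k - 1)).mpr ⟨by push_cast; linarith, by push_cast; linarith⟩]
      ring
    · rw [(Int.ceil_eq_iff (z := -k + 1)).mpr ⟨by push_cast; linarith, by push_cast; linarith⟩,
        (Int.ceil_eq_iff (z := -k)).mpr ⟨by push_cast; linarith, by push_cast; linarith⟩]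
      ring
  · push Not at h
    cases e <;> simp only [endRound, halfOpenInterval, Set.mem_Ico, Set.mem_Ioc] at *
    · have h2 := Int.floor_le (r - c)
      have h3 := Int.lt_floor_add_one (r - c)
      have h4 := h (-⌊r - c⌋ - 1)
      push_cast at h4
      rw [(Int.floor_eq_iff (z := ⌊r - c⌋)).mpr ⟨by linarith, ?_⟩, sub_self]
      by_contra! h5
      exact h4 ⟨by linarith, by linarith⟩
    · have h2 := Int.le_ceil (r - c)
      have h3 := Int.ceil_lt_add_one (r - c)
      have h4 := h (-⌈r - c⌉)
      push_cast at h4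
      rw [(Int.ceil_eq_iff (z := ⌈r - c⌉)).mpr ⟨by linarith, ?_⟩, sub_self]
      by_contra! h5
      exact h4 ⟨by linarith, by linarith⟩

/-! ### Letter counts and abelian equivalence -/

/-- A telescoping sum; `S` will be either a rounded line or a prefix count. -/
theorem count_wordBlock {A : Type*} [DecidableEq A] (x : ℕ → A) (a : A) (S : ℕ → ℤ)
    (h : ∀ n, S (n + 1) - S n = if x n = a then 1 else 0) (i n : ℕ) :
    ((wordBlock x i n).count a : ℤ) = S (i + n) - S i := by
  induction n with
  | zero => simp [wordBlock]
  | succ n ih =>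
    have hs : wordBlock x i (n + 1) = wordBlock x i n ++ [x (i + n)] := by
      rw [wordBlock, List.ofFn_succ_last]
      rfl
    rw [hs, List.count_append, Nat.cast_add, ih]
    have := h (i + n)
    rw [← add_assoc]
    by_cases hx : x (i + n) = a
    · simp [hx] at this ⊢
      omega
    · simp [hx] at this ⊢
      omega

theorem length_wordBlock {A : Type*} (x : ℕ → A) (i n : ℕ) : (wordBlock x i n).length = n := by
  simp [wordBlock]

theorem length_eq_count_add_count_add_count (w : List (Fin 3)) :
    w.length = w.count 0 + w.count 1 + w.count 2 := by
  induction w with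
  | nil => rfl
  | cons a w ih =>
    fin_cases a <;> simp [ih] <;> ring

/-- Words over three letters are abelian equivalent once lengths and two counts agree. -/
theorem abelianEquiv_fin_three {u v : List (Fin 3)} (hl : u.length = v.length)
    (h1 : u.count 1 = v.count 1) (h2 : u.count 2 = v.count 2) : AbelianEquiv u v := by
  have hu := length_eq_count_add_count_add_count u
  have hv := length_eq_count_add_count_add_count v
  intro a
  fin_cases a <;> simp <;> omega

theorem AbelianEquiv.length_eq {u v : List (Fin 3)} (h : AbelianEquiv u v) :
    u.length = v.length := by
  rw [length_eq_count_add_count_add_count u, length_eq_count_add_count_add_count v, h 0, h 1, h 2]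

/-! ### Dense orbits, disjoint arcs and counts in codings -/

/-- The forward orbit of an irrational rotation meets every open interval modulo one. -/
theorem exists_orbit_mem_Ioo {α : ℝ} (hα : Irrational α) (s : ℝ) {p q : ℝ} (hpq : p < q) :
    ∃ (n : ℕ) (k : ℤ), s + n * α + k ∈ Set.Ioo p q := by
  have hd : DenseRange (fun n : ℕ => n • (α : UnitAddCircle)) := by
    rw [← denseRange_zsmul_iff_nsmul, AddCircle.denseRange_zsmul_coe_iff, div_one]
    exact hα
  have hopen : IsOpen ((fun t : ℝ => (t : UnitAddCircle)) '' Set.Ioo (p - s) (q - s)) :=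
    QuotientAddGroup.isOpenMap_coe _ isOpen_Ioo
  obtain ⟨n, t, ht, hn⟩ := hd.exists_mem_open hopen
    (Set.image_nonempty.mpr (Set.nonempty_Ioo.mpr (by linarith)))
  rw [← AddCircle.coe_nsmul] at hn
  obtain ⟨k, hk⟩ := coe_eq_coe_iff_exists_int.mp hn.symm
  rw [nsmul_eq_mul] at hk
  rw [hk] at ht
  exact ⟨n, k, by linarith [ht.1], by linarith [ht.2]⟩

theorem disjoint_arcOne_arcTwo {e f : ArcEnd} {α ζ : ℝ} (hα0 : 0 < α)
    (hζ : ζ ∈ Set.Icc α (1 - α)) (hef : AdmissibleEnds e f α ζ) :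
    Disjoint (arcOne e α) (arcTwo f α ζ) := by
  rw [Set.disjoint_left]
  intro z h1 h2
  obtain ⟨r, rfl⟩ := QuotientAddGroup.mk_surjective z
  obtain ⟨k, hk⟩ := coe_mem_halfOpenArc.mp h1
  obtain ⟨l, hl⟩ := coe_mem_halfOpenArc.mp h2
  have hk' := halfOpenInterval_subset_Icc _ _ _ hk
  have hl' := halfOpenInterval_subset_Icc _ _ _ hl
  simp only [Set.mem_Icc] at hk' hl' hζ
  have h3 : l ≤ k := by
    have : (l : ℝ) < k + 1 := by linarith
    exact Int.lt_add_one_iff.mp (by exact_mod_cast this)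
  have h4 : k ≤ l + 1 := by
    have : (k : ℝ) ≤ l + 1 := by linarith
    exact_mod_cast this
  -- The closed arcs can touch only at `1 - α` (forcing `ζ = 1 - α`) or at `0` (forcing `ζ = α`),
  -- exactly the cases governed by admissibility.
  obtain rfl | rfl : k = l ∨ k = l + 1 := by omega
  · have hz : ζ = 1 - α := by linarith
    have hr : r + k = 1 - α := by linarith
    rw [hr] at hk hl
    cases e
    · rw [hef.2 hz rfl, hz] at hl
      exact lt_irrefl _ hl.2
    · exact lt_irrefl _ hk.1
  · push_cast at hk hk'
    have hz : ζ = α := by linarith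
    have hr : r + l = 0 := by linarith
    rw [← add_assoc, hr, zero_add] at hk
    rw [hr] at hl
    cases e
    · exact lt_irrefl _ hk.2
    · rw [hef.1 hz rfl, hz, sub_self] at hl
      exact lt_irrefl _ hl.1

theorem ternaryRotationWord_coe (e f : ArcEnd) (α ζ s : ℝ) (n : ℕ) :
    ternaryRotationWord e f α ζ (s : UnitAddCircle) n =
      ternaryCode e f α ζ ((s + n * α : ℝ) : UnitAddCircle) := by
  rw [ternaryRotationWord, AddCircle.coe_add, ← nsmul_eq_mul, AddCircle.coe_nsmul]

theorem ternaryCode_eq_one_iff {e f : ArcEnd} {α ζ : ℝ} {z : UnitAddCircle} :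
    ternaryCode e f α ζ z = 1 ↔ z ∈ arcOne e α := by
  unfold ternaryCode
  split_ifs with h1 h2 <;> simp [h1]

theorem ternaryCode_eq_two_iff {e f : ArcEnd} {α ζ : ℝ}
    (h : Disjoint (arcOne e α) (arcTwo f α ζ)) {z : UnitAddCircle} :
    ternaryCode e f α ζ z = 2 ↔ z ∈ arcTwo f α ζ := by
  have h' : z ∈ arcOne e α → z ∉ arcTwo f α ζ := fun h1 => Set.disjoint_left.mp h h1
  unfold ternaryCode
  split_ifs with h1 h2
  · simp [h' h1]
  · simp [h2]
  · simp [h2]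

open Classical in
theorem count_one_wordBlock_ternaryRotationWord (e f : ArcEnd) {α : ℝ} (ζ s : ℝ) (hα0 : 0 < α)
    (hα1 : α < 1) (i n : ℕ) :
    ((wordBlock (ternaryRotationWord e f α ζ (s : UnitAddCircle)) i n).count 1 : ℤ) =
      endRound e (s + i * α + n * α) - endRound e (s + i * α) := by
  rw [count_wordBlock _ _ (fun n : ℕ => endRound e (s + n * α))]
  · push_cast
    rw [add_mul, ← add_assoc]
  · intro n
    rw [ternaryRotationWord_coe, ite_congr (propext ternaryCode_eq_one_iff) (fun _ => rfl)
      (fun _ => rfl), arcOne, ← endRound_add_sub_eq_ite e hα0 hα1]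
    have h1 := endRound_add_int e (s + n * α - 1 + α) 1
    have h2 := endRound_add_int e (s + n * α - 1) 1
    push_cast at h1 h2 ⊢
    rw [show s + n * α - 1 + α + 1 = s + (n + 1) * α by ring] at h1
    rw [sub_add_cancel] at h2
    omega

open Classical in
theorem count_two_wordBlock_ternaryRotationWord {e f : ArcEnd} {α ζ : ℝ} (s : ℝ) (hα0 : 0 < α)
    (hα1 : α < 1) (h : Disjoint (arcOne e α) (arcTwo f α ζ)) (i n : ℕ) :
    ((wordBlock (ternaryRotationWord e f α ζ (s : UnitAddCircle)) i n).count 2 : ℤ) =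
      endRound f (s + i * α - ζ + n * α) - endRound f (s + i * α - ζ) := by
  rw [count_wordBlock _ _ (fun n : ℕ => endRound f (s + n * α - ζ))]
  · push_cast
    rw [show s + (i + n) * α - ζ = s + i * α - ζ + n * α by ring]
  · intro n
    rw [ternaryRotationWord_coe, ite_congr (propext (ternaryCode_eq_two_iff h)) (fun _ => rfl)
      (fun _ => rfl), arcTwo, ← endRound_add_sub_eq_ite f hα0 hα1]
    push_cast
    rw [show s + (n + 1) * α - ζ = s + n * α - ζ + α by ring]

/-! ### Every ternary coding lies in the abelian closure -/

/-- An integer that differs from `m + b` by less than one is `m` or `m + 1`. -/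
theorem eq_or_eq_add_one_of_abs_lt {x m : ℤ} {b : ℝ} (h0 : 0 ≤ b) (h1 : b < 1)
    (h : |(x : ℝ) - (m + b)| < 1) : x = m ∨ x = m + 1 := by
  rw [abs_lt] at h
  have h2 : m < x + 1 := by
    have : (m : ℝ) < x + 1 := by linarith
    exact_mod_cast this
  have h3 : x < m + 2 := by
    have : (x : ℝ) < m + 2 := by linarith
    exact_mod_cast this
  omega

/-- An offset in `[α, 1 - α]` keeps distance `α` from the integers. -/
theorem le_of_two_int_near {α ζ b s : ℝ} (hζ : ζ ∈ Set.Icc α (1 - α)) {k l : ℤ}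
    (h1 : s ≤ k) (h2 : (k : ℝ) ≤ s + b) (h3 : s ≤ l + ζ) (h4 : l + ζ ≤ s + b) : α ≤ b := by
  simp only [Set.mem_Icc] at hζ
  rcases le_or_gt k l with h | h
  · have : (k : ℝ) ≤ l := by exact_mod_cast h
    linarith
  · have : (l : ℝ) + 1 ≤ k := by exact_mod_cast h
    linarith

/-- The pairs of increments realised by the word with offset `α`, on open sets of positions. -/
theorem exists_Ioo_endRound_sub_eq {α b : ℝ} {m x y : ℤ} (hα0 : 0 < α) (hα1 : α < 1)
    (hb0 : 0 < b) (hb1 : b < 1)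
    (hx : x = m ∨ x = m + 1) (hy : y = m ∨ y = m + 1)
    (hlow : x = m → y = m → b < 1 - α) (hhigh : x = m + 1 → y = m + 1 → α < b) :
    ∃ p q : ℝ, p < q ∧ ∀ (e f : ArcEnd), ∀ s ∈ Set.Ioo p q,
      endRound e (s + (m + b)) - endRound e s = x ∧
        endRound f (s - α + (m + b)) - endRound f (s - α) = y := by
  rcases hx with rfl | rfl <;> rcases hy with rfl | rfl
  · have := hlow rfl rfl
    -- In each case the interval says which of the windows `[s, s + b]`, `[s - α, s - α + b]`
    -- straddle `0`; here both lie inside `(0, 1)`.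
    refine ⟨α, 1 - b, by linarith, fun e f s hs => ⟨?_, ?_⟩⟩ <;> rw [Set.mem_Ioo] at hs
    · exact endRound_sub_eq_of_around hb0.le 0 (by push_cast; linarith) (by push_cast; linarith)
    · exact endRound_sub_eq_of_around hb0.le 0 (by push_cast; linarith) (by push_cast; linarith)
  · refine ⟨max 0 (α - b), min (1 - b) α, ?_, fun e f s hs => ⟨?_, ?_⟩⟩
    · rw [max_lt_iff, lt_min_iff, lt_min_iff]
      refine ⟨⟨?_, ?_⟩, ?_, ?_⟩ <;> linarith
    all_goals rw [Set.mem_Ioo, max_lt_iff, lt_min_iff] at hs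
    · exact endRound_sub_eq_of_around hb0.le 0 (by push_cast; linarith) (by push_cast; linarith)
    · exact endRound_sub_eq_of_between hb1.le 0 (by push_cast; linarith) (by push_cast; linarith)
  · refine ⟨max (-b) (α - 1), min 0 (α - b), ?_, fun e f s hs => ⟨?_, ?_⟩⟩
    · rw [max_lt_iff, lt_min_iff, lt_min_iff]
      refine ⟨⟨?_, ?_⟩, ?_, ?_⟩ <;> linarith
    all_goals rw [Set.mem_Ioo, max_lt_iff, lt_min_iff] at hs
    · exact endRound_sub_eq_of_between hb1.le 0 (by push_cast; linarith) (by push_cast; linarith)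
    · exact endRound_sub_eq_of_around hb0.le (-1) (by push_cast; linarith) (by push_cast; linarith)
  · have := hhigh rfl rfl
    refine ⟨α - b, 0, by linarith, fun e f s hs => ⟨?_, ?_⟩⟩ <;> rw [Set.mem_Ioo] at hs
    · exact endRound_sub_eq_of_between hb1.le 0 (by push_cast; linarith) (by push_cast; linarith)
    · exact endRound_sub_eq_of_between hb1.le 0 (by push_cast; linarith) (by push_cast; linarith)

/-- Every factor of a ternary coding is abelian equivalent to a factor of one with offset `α`. -/
theorem exists_wordBlock_abelianEquiv {α ζ : ℝ} (hα : Irrational α) (hα0 : 0 < α)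
    (hα1 : α < 1 / 2) (hζ : ζ ∈ Set.Icc α (1 - α)) {e f e' f' : ArcEnd}
    (hef : AdmissibleEnds e f α α) (hef' : AdmissibleEnds e' f' α ζ) (s t : ℝ) (i n : ℕ) :
    ∃ j : ℕ, AbelianEquiv (wordBlock (ternaryRotationWord e' f' α ζ (t : UnitAddCircle)) i n)
      (wordBlock (ternaryRotationWord e f α α (s : UnitAddCircle)) j n) := by
  rcases Nat.eq_zero_or_pos n with rfl | hn
  · exact ⟨0, by simp [wordBlock, AbelianEquiv]⟩
  have hα1' : α < 1 := by linarith
  have hdis := disjoint_arcOne_arcTwo hα0 ⟨le_refl α, by linarith⟩ hef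
  have hdis' := disjoint_arcOne_arcTwo hα0 hζ hef'
  have hc1 := count_one_wordBlock_ternaryRotationWord e' f' ζ t hα0 hα1' i n
  have hc2 := count_two_wordBlock_ternaryRotationWord t hα0 hα1' hdis' i n
  set w := wordBlock (ternaryRotationWord e' f' α ζ (t : UnitAddCircle)) i n with hw
  set r := t + i * α with hr
  obtain ⟨m, b, hb0, hb1, hmb⟩ : ∃ (m : ℤ) (b : ℝ), 0 < b ∧ b < 1 ∧ n * α = m + b := by
    have hirr : Irrational (n * α) := hα.natCast_mul hn.ne'
    refine ⟨⌊n * α⌋, Int.fract (n * α), ?_, Int.fract_lt_one _, (Int.floor_add_fract _).symm⟩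
    exact lt_of_le_of_ne (Int.fract_nonneg _) fun h =>
      hirr ⟨⌊n * α⌋, by have := Int.floor_add_fract (n * α); rw [← h] at this; simpa using this⟩
  have hne : ∀ k l : ℤ, k * α = l → k = 0 := by
    intro k l h
    by_contra hk
    exact (hα.intCast_mul hk) ⟨l, by simpa using h.symm⟩
  have hx := eq_or_eq_add_one_of_abs_lt (m := m) (x := w.count 1) hb0.le hb1 (by
    have := abs_endRound_sub_lt e' (r + n * α) r
    rw [add_sub_cancel_left] at this
    rwa [hc1, ← hmb])
  have hy := eq_or_eq_add_one_of_abs_lt (m := m) (x := w.count 2) hb0.le hb1 (by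
    have := abs_endRound_sub_lt f' (r - ζ + n * α) (r - ζ)
    rw [add_sub_cancel_left] at this
    rwa [hc2, ← hmb])
  obtain ⟨p, q, hpq, hpos⟩ := exists_Ioo_endRound_sub_eq hα0 hα1' hb0 hb1 hx hy
    (by
      intro h1 h2
      rw [hc1, hmb] at h1
      rw [hc2, hmb] at h2
      obtain ⟨k, hk1, hk2⟩ := exists_int_around_of_endRound_sub h1
      obtain ⟨l, hl1, hl2⟩ := exists_int_around_of_endRound_sub h2
      -- The complementary window `[r + b - 1, r]`, of length `1 - b`, contains both `k` and `l +
      -- ζ`.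
      have hle : α ≤ 1 - b := le_of_two_int_near (s := r + b - 1) hζ (k := k) (l := l)
        (by linarith) (by linarith) (by linarith) (by linarith)
      refine lt_of_le_of_ne (by linarith) fun h => ?_
      have := hne (n + 1) (m + 1) (by push_cast; linarith)
      omega)
    (by
      intro h1 h2
      have hlen := length_eq_count_add_count_add_count w
      rw [hw, length_wordBlock, ← hw] at hlen
      rw [hc1, hmb] at h1
      rw [hc2, hmb] at h2
      obtain ⟨k, hk1, hk2⟩ := exists_int_between_of_endRound_sub h1
      obtain ⟨l, hl1, hl2⟩ := exists_int_between_of_endRound_sub h2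
      have hle : α ≤ b := le_of_two_int_near (s := r) hζ (k := k) (l := l)
        (by linarith) (by linarith) (by linarith) (by linarith)
      -- Equality `b = α` forces `n = 1`, `m = 0`, and one letter cannot be both `1` and `2`.
      refine lt_of_le_of_ne hle fun h => ?_
      have hn1 := hne (n - 1) m (by push_cast; linarith)
      have hn1' : n = 1 := by omega
      subst hn1'
      have hm : m = 0 := by
        have : (m : ℝ) = 0 := by push_cast at hmb; linarith
        exact_mod_cast this
      rw [hmb, h1] at hc1
      rw [hmb, h2] at hc2
      omega)
  obtain ⟨j, k, hj⟩ := exists_orbit_mem_Ioo hα s hpq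
  obtain ⟨hp1, hp2⟩ := hpos e f _ hj
  refine ⟨j, abelianEquiv_fin_three (by simp [hw, length_wordBlock]) ?_ ?_⟩
  · have := count_one_wordBlock_ternaryRotationWord e f α s hα0 hα1' j n
    rw [endRound_add_int, ← hmb, add_right_comm, endRound_add_int] at hp1
    omega
  · have := count_two_wordBlock_ternaryRotationWord s hα0 hα1' hdis j n
    rw [← hmb, show s + j * α + k - α + n * α = s + j * α - α + n * α + k by ring,
      show s + j * α + k - α = s + j * α - α + k by ring, endRound_add_int,
      endRound_add_int] at hp2
    omega

/-! ### Words in the abelian closure are ternary codings -/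

/-- An integer sequence of irrational slope and deviation below one is a rounded line. -/
theorem exists_eq_endRound {α : ℝ} (S : ℕ → ℤ)
    (h : ∀ k n : ℕ, |((S (k + n) - S k : ℤ) : ℝ) - n * α| < 1) :
    ∃ (e : ArcEnd) (s : ℝ), ∀ n : ℕ, S n = endRound e (s + n * α) := by
  set D : ℕ → ℝ := fun n => S n - n * α with hD
  have hlt : ∀ k n, D k < D n + 1 := by
    intro k n
    rcases le_total k n with hkn | hkn <;> obtain ⟨d, rfl⟩ := Nat.exists_eq_add_of_le hkn
    · have := (abs_lt.mp (h k d)).1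
      simp only [hD]
      push_cast at this ⊢
      linarith
    · have := (abs_lt.mp (h n d)).2
      simp only [hD]
      push_cast at this ⊢
      linarith
  have hbdd : BddAbove (Set.range D) := ⟨D 0 + 1, by rintro _ ⟨n, rfl⟩; exact (hlt n 0).le⟩
  have hle : ∀ n, D n ≤ iSup D := le_ciSup hbdd
  have hge : ∀ n, iSup D ≤ D n + 1 := fun n => ciSup_le fun k => (hlt k n).le
  -- Always `D n ≤ iSup D ≤ D n + 1`. If the upper bound is attained, the lower one is strict for
  -- all `n`, which suits the ceiling; otherwise the upper one is strict, which suits the floor.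
  by_cases hex : ∃ n, iSup D = D n + 1
  · obtain ⟨n₀, hn₀⟩ := hex
    refine ⟨ArcEnd.final, iSup D - 1, fun n => ((Int.ceil_eq_iff).mpr ⟨?_, ?_⟩).symm⟩
    · have := hlt n n₀
      simp only [hD] at this hn₀ ⊢
      linarith
    · have := hge n
      simp only [hD] at this ⊢
      linarith
  · refine ⟨ArcEnd.initial, iSup D, fun n => ((Int.floor_eq_iff).mpr ⟨?_, ?_⟩).symm⟩
    · have := hle n
      simp only [hD] at this ⊢
      linarith
    · have := lt_of_le_of_ne (hge n) fun h => hex ⟨n, h⟩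
      simp only [hD] at this ⊢
      linarith

theorem eq_ternaryRotationWord {e f : ArcEnd} {α ζ s : ℝ} {y : ℕ → Fin 3}
    (h1 : ∀ n : ℕ, y n = 1 ↔ ((s + n * α : ℝ) : UnitAddCircle) ∈ arcOne e α)
    (h2 : ∀ n : ℕ, y n = 2 ↔ ((s + n * α : ℝ) : UnitAddCircle) ∈ arcTwo f α ζ) :
    y = ternaryRotationWord e f α ζ (s : UnitAddCircle) := by
  funext n
  rw [ternaryRotationWord_coe, ternaryCode]
  split_ifs with h3 h4
  · exact (h1 n).mpr h3
  · exact (h2 n).mpr h4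
  · have h5 := mt (h1 n).mp h3
    have h6 := mt (h2 n).mp h4
    generalize y n = a at h5 h6
    fin_cases a <;> simp_all

/-- Off its end points an arc does not depend on which end point it contains. -/
theorem coe_mem_halfOpenArc_congr {e e' : ArcEnd} {a b r : ℝ} (ha : ∀ k : ℤ, r + k ≠ a)
    (hb : ∀ k : ℤ, r + k ≠ b) :
    (r : UnitAddCircle) ∈ halfOpenArc e a b ↔ (r : UnitAddCircle) ∈ halfOpenArc e' a b := by
  rw [coe_mem_halfOpenArc, coe_mem_halfOpenArc]
  have key : ∀ (c : ArcEnd) (k : ℤ), r + k ∈ halfOpenInterval c a b ↔ r + k ∈ Set.Ioo a b := by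
    refine fun c k => ⟨fun h => ?_, fun h => Ioo_subset_halfOpenInterval c a b h⟩
    have h' := halfOpenInterval_subset_Icc c a b h
    exact ⟨lt_of_le_of_ne h'.1 (ha k).symm, lt_of_le_of_ne h'.2 (hb k)⟩
  exact exists_congr fun k => (key e k).trans (key e' k).symm

/-- A word read off two arcs along an orbit is an admissible ternary coding. -/
theorem exists_admissible_of_arcs {e f : ArcEnd} {α ζ s : ℝ} {y : ℕ → Fin 3}
    (hα : Irrational α) (hα0 : 0 < α) (hζ : ζ ∈ Set.Ico (0 : ℝ) 1)
    (h1 : ∀ n : ℕ, y n = 1 ↔ ((s + n * α : ℝ) : UnitAddCircle) ∈ arcOne e α)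
    (h2 : ∀ n : ℕ, y n = 2 ↔ ((s + n * α : ℝ) : UnitAddCircle) ∈ arcTwo f α ζ) :
    ζ ∈ Set.Icc α (1 - α) ∧ ∃ e' f' : ArcEnd, AdmissibleEnds e' f' α ζ ∧
      y = ternaryRotationWord e' f' α ζ (s : UnitAddCircle) := by
  have hnot : ∀ (n : ℕ) (k l : ℤ), s + n * α + k ∈ halfOpenInterval e (1 - α) 1 →
      s + n * α + l ∉ halfOpenInterval f (ζ - α) ζ := by
    intro n k l hk hl
    have h3 := (h1 n).mpr (coe_mem_halfOpenArc.mpr ⟨k, hk⟩)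
    have h4 := (h2 n).mpr (coe_mem_halfOpenArc.mpr ⟨l, hl⟩)
    rw [h3] at h4
    exact absurd h4 (by decide)
  simp only [Set.mem_Ico] at hζ
  have hζ' : ζ ∈ Set.Icc α (1 - α) := by
    constructor
    · by_contra! hlt
      have hpq : max (-α) (ζ - α) < min 0 ζ := by
        rw [max_lt_iff, lt_min_iff, lt_min_iff]
        refine ⟨⟨?_, ?_⟩, ?_, ?_⟩ <;> linarith
      obtain ⟨n, k, hn⟩ := exists_orbit_mem_Ioo hα s hpq
      rw [Set.mem_Ioo, max_lt_iff, lt_min_iff] at hn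
      refine hnot n (k + 1) k (Ioo_subset_halfOpenInterval _ _ _ ⟨?_, ?_⟩)
        (Ioo_subset_halfOpenInterval _ _ _ ⟨hn.1.2, hn.2.2⟩) <;> push_cast <;> linarith
    · by_contra! hlt
      have hpq : max (1 - α) (ζ - α) < ζ := max_lt hlt (by linarith)
      obtain ⟨n, k, hn⟩ := exists_orbit_mem_Ioo hα s hpq
      rw [Set.mem_Ioo, max_lt_iff] at hn
      exact hnot n k k (Ioo_subset_halfOpenInterval _ _ _ ⟨hn.1.1, by linarith⟩)
        (Ioo_subset_halfOpenInterval _ _ _ ⟨hn.1.2, hn.2⟩)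
  refine ⟨hζ', ?_⟩
  -- In an inadmissible choice both arcs contain a common end point, which the orbit must avoid. It
  -- then also avoids the point `α` earlier, so switching one arc's end point changes no letter.
  by_cases hbad : ζ = α ∧ e = ArcEnd.final ∧ f = ArcEnd.initial
  · obtain ⟨rfl, rfl, rfl⟩ := hbad
    have hz : ∀ (n : ℕ) (k : ℤ), s + n * ζ + k ≠ 1 := by
      intro n k h
      refine hnot n k (k - 1) ?_ ?_
      · rw [h]
        exact ⟨by linarith, le_rfl⟩
      · push_cast
        rw [← add_sub_assoc, h]
        exact ⟨by linarith, by linarith⟩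
    refine ⟨ArcEnd.initial, ArcEnd.initial, ⟨fun _ h => h, fun _ _ => rfl⟩,
      eq_ternaryRotationWord (fun n => (h1 n).trans ?_) h2⟩
    refine coe_mem_halfOpenArc_congr (fun k h => hz (n + 1) k ?_) (hz n)
    push_cast
    linarith
  by_cases hbad' : ζ = 1 - α ∧ e = ArcEnd.initial ∧ f = ArcEnd.final
  · obtain ⟨hζα, rfl, rfl⟩ := hbad'
    have hz : ∀ (n : ℕ) (k : ℤ), s + n * α + k ≠ ζ := by
      intro n k h
      refine hnot n k k ?_ ?_ <;> rw [h]
      · exact ⟨hζα.ge, hζ.2⟩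
      · exact ⟨by linarith, le_rfl⟩
    refine ⟨ArcEnd.initial, ArcEnd.initial, ⟨fun _ h => h, fun _ _ => rfl⟩,
      eq_ternaryRotationWord h1 (fun n => (h2 n).trans ?_)⟩
    refine coe_mem_halfOpenArc_congr (fun k h => hz (n + 1) k ?_) (hz n)
    push_cast
    linarith
  refine ⟨e, f, ⟨fun h he => ?_, fun h he => ?_⟩, eq_ternaryRotationWord h1 h2⟩
  · cases f
    · exact absurd ⟨h, he, rfl⟩ hbad
    · rfl
  · cases f
    · rfl
    · exact absurd ⟨h, he, rfl⟩ hbad'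

open Classical in
/-- A word with the abelian factors of a ternary coding of offset `α` is a ternary coding. -/
theorem exists_eq_ternaryRotationWord_of_mem_abelianClosure {α s : ℝ} (hα : Irrational α)
    (hα0 : 0 < α) (hα1 : α < 1 / 2) {e f : ArcEnd} (hef : AdmissibleEnds e f α α)
    {y : ℕ → Fin 3}
    (hy : y ∈ abelianClosure (ternaryRotationWord e f α α (s : UnitAddCircle))) :
    ∃ ζ ∈ Set.Icc α (1 - α), ∃ (t : ℝ) (e' f' : ArcEnd), AdmissibleEnds e' f' α ζ ∧
      y = ternaryRotationWord e' f' α ζ (t : UnitAddCircle) := by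
  have hα1' : α < 1 := by linarith
  have hdis := disjoint_arcOne_arcTwo hα0 ⟨le_refl α, by linarith⟩ hef
  set S : Fin 3 → ℕ → ℤ := fun a n => ∑ k ∈ Finset.range n, if y k = a then 1 else 0 with hS
  have hstep : ∀ a n, S a (n + 1) - S a n = if y n = a then 1 else 0 := by
    intro a n
    simp only [hS, Finset.sum_range_succ, add_sub_cancel_left]
  have hvec : ∀ k n : ℕ, ∃ i : ℕ, ∀ a, S a (k + n) - S a k =
      (wordBlock (ternaryRotationWord e f α α (s : UnitAddCircle)) i n).count a := by
    intro k n
    obtain ⟨v, ⟨i, n', rfl⟩, hv⟩ := hy _ ⟨k, n, rfl⟩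
    have hl := hv.length_eq
    rw [length_wordBlock, length_wordBlock] at hl
    subst hl
    refine ⟨i, fun a => ?_⟩
    rw [← hv a, ← count_wordBlock y a (S a) (hstep a)]
  obtain ⟨e', s₁, h1⟩ := exists_eq_endRound (α := α) (S 1) (by
    intro k n
    obtain ⟨i, hi⟩ := hvec k n
    rw [hi, count_one_wordBlock_ternaryRotationWord e f α s hα0 hα1']
    have := abs_endRound_sub_lt e (s + i * α + n * α) (s + i * α)
    rwa [add_sub_cancel_left] at this)
  obtain ⟨f', s₂, h2⟩ := exists_eq_endRound (α := α) (S 2) (by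
    intro k n
    obtain ⟨i, hi⟩ := hvec k n
    rw [hi, count_two_wordBlock_ternaryRotationWord s hα0 hα1' hdis]
    have := abs_endRound_sub_lt f (s + i * α - α + n * α) (s + i * α - α)
    rwa [add_sub_cancel_left] at this)
  have hite : ∀ {p q : Prop} [Decidable p] [Decidable q],
      (if p then (1 : ℤ) else 0) = (if q then 1 else 0) → (p ↔ q) := by
    intro p q _ _ h
    split_ifs at h <;> simp_all
  obtain ⟨hζ, e'', f'', hadm, heq⟩ := exists_admissible_of_arcs (e := e') (f := f') (α := α)
    -- The offset matters only modulo one: `endRound_add_int` absorbs the integer part of `s₁ - s₂`.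
    (ζ := Int.fract (s₁ - s₂)) (s := s₁) (y := y) hα hα0
    ⟨Int.fract_nonneg _, Int.fract_lt_one _⟩
    (by
      intro n
      apply hite
      rw [← hstep, h1, h1, arcOne, ← endRound_add_sub_eq_ite e' hα0 hα1']
      have h3 := endRound_add_int e' (s₁ + n * α - 1 + α) 1
      have h4 := endRound_add_int e' (s₁ + n * α - 1) 1
      push_cast at h3 h4 ⊢
      rw [show s₁ + n * α - 1 + α + 1 = s₁ + (n + 1) * α by ring] at h3
      rw [sub_add_cancel] at h4
      omega)
    (by
      intro n
      apply hite
      rw [← hstep, h2, h2, arcTwo, ← endRound_add_sub_eq_ite f' hα0 hα1']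
      have h5 : Int.fract (s₁ - s₂) = s₁ - s₂ - ⌊s₁ - s₂⌋ := rfl
      rw [show s₁ + n * α - Int.fract (s₁ - s₂) + α = s₂ + (n + 1) * α + ⌊s₁ - s₂⌋ by
        rw [h5]; ring, show s₁ + n * α - Int.fract (s₁ - s₂) = s₂ + n * α + ⌊s₁ - s₂⌋ by
        rw [h5]; ring, endRound_add_int, endRound_add_int]
      push_cast
      ring)
  exact ⟨_, hζ, s₁, e'', f'', hadm, heq⟩

theorem mainTheorem7 (α : ℝ) (hα : Irrational α) (hα0 : 0 < α) (hα1 : α < 1 / 2)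
    (e f : ArcEnd) (hef : AdmissibleEnds e f α α) (ρ : UnitAddCircle) :
    abelianClosure (ternaryRotationWord e f α α ρ) =
      ⋃ ζ ∈ Set.Icc α (1 - α), ⋃ (ρ' : UnitAddCircle) (e' : ArcEnd) (f' : ArcEnd)
        (_ : AdmissibleEnds e' f' α ζ), orbitClosure (ternaryRotationWord e' f' α ζ ρ') := by
  obtain ⟨s, rfl⟩ := QuotientAddGroup.mk_surjective ρ
  ext y
  simp only [Set.mem_iUnion, exists_prop]
  constructor
  · intro hy
    obtain ⟨ζ, hζ, t, e', f', hadm, rfl⟩ :=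
      exists_eq_ternaryRotationWord_of_mem_abelianClosure hα hα0 hα1 hef hy
    exact ⟨ζ, hζ, t, e', f', hadm, fun _ h => h⟩
  · rintro ⟨ζ, hζ, ρ', e', f', hadm, hy⟩ w hw
    obtain ⟨t, rfl⟩ := QuotientAddGroup.mk_surjective ρ'
    obtain ⟨i, n, rfl⟩ := hy hw
    obtain ⟨j, hj⟩ := exists_wordBlock_abelianEquiv hα hα0 hα1 hζ hef hadm s t i n
    exact ⟨_, ⟨j, n, rfl⟩, hj⟩
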